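/- Let $m\ge 1$. Consider a model $\mathfrak F$ (a set of probability measures on a measurable space $\mathcal X$), null hypotheses $H_1,\dots,H_m\subseteq\mathfrak F$ and measurable $p$-values $p_1,\dots,p_m:\mathcal X\to[0,1]$ (possibly discrete). For $\mu\in\mathfrak F$ let $\mathcal H_0(\mu)=\{i:\mu\in H_i\}$. Assume that for every $\mu\in\mathfrak F$ the true null $p$-values $(p_i)_{i\in\mathcal H_0(\mu)}$ are super-uniform under $\mu$, i.e. $\mathbb P_\mu(p_i\le x)\le 0\vee(x\wedge 1)$ for all $x\in\mathbb R$ and $i\in\mathcal H_0(\mu)$, and mutually independent under $\mu$. Let $\alpha\in(0,1)$, $\mu\in\mathfrak F$ and let $X$ be a random variable with law $\mu$. Write $p_i=p_i(X)$, let $p_{(1)}\le\dots\le p_{(m)}$ be the order statistics of $(p_1,\dots,p_m)$, let $\sigma$ be any (random) permutation of $\{1,\dots,m\}$ with $p_{\sigma(k)}=p_{(k)}$ for all $k$ (ties may be broken in any way), and let $R_k=\{\sigma(1),\dots,\sigma(k)\}$. Then, for each of the following three choices of $(\zeta_k)_{1\le k\le m}$, the family $(R_k,\zeta_k)_{1\le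 k\le m}$ controls the joint error rate at level $\alpha$: $$\mathrm{JER}=\mathbb P\bigl(\exists k\in\{1,\dots,m\}:\ |R_k\cap\mathcal H_0(\mu)|>\zeta_k\bigr)\le\alpha .$$ 1. (DKW) $\displaystyle \zeta_k=\Bigl(\mathbf 1\{p_{(k)}>0\}\Bigl\lfloor m p_{(k)}+\sqrt{\tfrac m2\log\tfrac1\alpha}\Bigr\rfloor\Bigr)\wedge k$; 2. (uniform Wellner) $\displaystyle \zeta_k=\Bigl(\mathbf 1\{p_{(k)}>0\}\Bigl\lfloor m p_{(k)}\,h^{-1}\Bigl(\frac{2\log(\kappa/\alpha)+4\log\bigl(1+\log_2(1/p_{(k)})\bigr)}{m p_{(k)}}\Bigr)\Bigr\rfloor\Bigr)\wedge k$, where $\kappa=\pi^2/6$ and $h^{-1}:(0,\infty)\to(1,\infty)$ is the inverse of $h(x)=x(\log x-1)+1$, $x>1$; 3. (Simes) $\displaystyle \zeta_k=\Bigl(\mathbf 1\{p_{(k)}>0\}\Bigl\lfloor \Bigl(\frac{m p_{(k)}}{\alpha}\Bigr)^{-}\Bigr\rfloor\Bigr)\wedge k$, where $\lfloor t^-\rfloor$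 is the left-limit of the floor function at $t$, that is, $\lceil t\rceil-1$. Here $\zeta_k=0$ when $p_{(k)}=0$. -/

import Mathlib

open MeasureTheory ProbabilityTheory

namespace MultipleTesting

/-- A multiple testing problem with `m` null hypotheses on the measurable space `𝓧`: a model (a set
of probability measures), `m` submodels (the null hypotheses), and `m` `[0,1]`-valued statistics
(the `p`-values). -/
structure Problem (𝓧 : Type*) [MeasurableSpace 𝓧] (m : ℕ) where
  model : Set (Measure 𝓧)
  isProbabilityMeasure : ∀ μ ∈ model, IsProbabilityMeasure μ
  null : Fin m → Set (Measure 𝓧)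
  null_subset : ∀ i, null i ⊆ model
  pval : Fin m → 𝓧 → ℝ
  measurable_pval : ∀ i, Measurable (pval i)
  pval_mem : ∀ i x, pval i x ∈ Set.Icc (0 : ℝ) 1

section Problem

variable {𝓧 : Type*} [MeasurableSpace 𝓧] {m : ℕ}

open scoped Classical in
/-- The set `𝓗₀(μ)` of the indices of the null hypotheses that are true under `μ`. -/
noncomputable def Problem.trueNulls (T : Problem 𝓧 m) (μ : Measure 𝓧) : Finset (Fin m) :=
  Finset.univ.filter fun i => μ ∈ T.null i

/-- Super-uniformity under the null: under every `μ` of the model, the cdf of each true null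
`p`-value is at most the cdf `x ↦ 0 ∨ (x ∧ 1)` of the uniform distribution on `[0,1]`. -/
def Problem.SuperUniformUnderNull (T : Problem 𝓧 m) : Prop :=
  ∀ μ ∈ T.model, ∀ i ∈ T.trueNulls μ, ∀ x : ℝ, μ.real {y | T.pval i y ≤ x} ≤ max 0 (min x 1)

/-- Independence under the null: under every `μ` of the model, the true null `p`-values are
mutually independent. -/
def Problem.IndependentUnderNull (T : Problem 𝓧 m) : Prop :=
  ∀ μ ∈ T.model, iIndepFun (fun i : T.trueNulls μ => T.pval i) μ

end Problem

/-- A family `(R_k, ζ_k)` of sets `R_k` of hypotheses and of natural numbers `ζ_k`. -/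
structure ReferenceFamily (m : ℕ) (ι : Type*) where
  region : ι → Finset (Fin m)
  bound : ι → ℕ

/-- The joint error rate of a random reference family when `H₀` is the set of true nulls: the
probability that `|R_k ∩ H₀| > ζ_k` for some `k`. -/
noncomputable def JER {Ω : Type*} [MeasurableSpace Ω] (P : Measure Ω) {m : ℕ} {ι : Type*}
    (𝓡 : Ω → ReferenceFamily m ι) (H₀ : Finset (Fin m)) : ℝ :=
  P.real {ω | ∃ k, (𝓡 ω).bound k < ((𝓡 ω).region k ∩ H₀).card}

/-- The order statistics `x_(1) ≤ ⋯ ≤ x_(m)`; the index `k : Fin m` stands for `k + 1`. -/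
noncomputable def orderStat {m : ℕ} (x : Fin m → ℝ) (k : Fin m) : ℝ :=
  x (Tuple.sort x k)

/-- The permutation `σ` orders `x`, that is, `x_{σ(k)} = x_(k)` for all `k`. -/
def Orders {m : ℕ} (σ : Equiv.Perm (Fin m)) (x : Fin m → ℝ) : Prop :=
  ∀ k, x (σ k) = orderStat x k

/-- A permutation orders `x` exactly when it makes `x` nondecreasing. -/
theorem orders_iff_monotone {m : ℕ} (σ : Equiv.Perm (Fin m)) (x : Fin m → ℝ) :
    Orders σ x ↔ Monotone (x ∘ σ) := by
  constructor
  · intro h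
    have : x ∘ σ = x ∘ Tuple.sort x := funext h
    rw [this]
    exact Tuple.monotone_sort x
  · intro h k
    exact congrFun (Tuple.unique_monotone h (Tuple.monotone_sort x)) k

/-- The top-`k` reference family of the `p`-values `x`, ordered by `σ`, with the bound function `f`:
`R_k = {σ(1), …, σ(k)}` and `ζ_k = 1{x_(k) > 0} f(x_(k)) ∧ k`.
The index `k : Fin m` stands for `k + 1`. -/
noncomputable def topKFamily {m : ℕ} (f : ℝ → ℕ) (x : Fin m → ℝ) (σ : Equiv.Perm (Fin m)) :
    ReferenceFamily m (Fin m) where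
  region k := (Finset.Iic k).image σ
  bound k := min ((Set.Ioi (0 : ℝ)).indicator f (orderStat x k)) ((k : ℕ) + 1)

/-- `h(x) = x (log x - 1) + 1`, to be used for `x > 1`. -/
noncomputable def wellnerH (x : ℝ) : ℝ := x * (Real.log x - 1) + 1

/-- The inverse of `h : (1, ∞) → (0, ∞)`. -/
noncomputable def wellnerHInv : ℝ → ℝ := Function.invFunOn wellnerH (Set.Ioi 1)

/-- The left-limit `⌊t⁻⌋` of the floor function at `t`. -/
noncomputable def floorLeft (t : ℝ) : ℕ := Function.leftLim (fun s : ℝ => ⌊s⌋₊) t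

/-- DKW bound function `t ↦ ⌊m t + √(m/2 · log(1/α))⌋`. -/
noncomputable def dkwBound (m : ℕ) (α t : ℝ) : ℕ :=
  ⌊m * t + √((m : ℝ) / 2 * Real.log (1 / α))⌋₊

/-- Wellner bound function, with `κ = π² / 6`:
`t ↦ ⌊m t h⁻¹((2 log(κ/α) + 4 log(1 + log₂(1/t))) / (m t))⌋`. -/
noncomputable def wellnerBound (m : ℕ) (α t : ℝ) : ℕ :=
  ⌊m * t * wellnerHInv
    ((2 * Real.log (Real.pi ^ 2 / 6 / α) + 4 * Real.log (1 + Real.logb 2 (1 / t))) / (m * t))⌋₊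

/-- Simes bound function `t ↦ ⌊(m t / α)⁻⌋`. -/
noncomputable def simesBound (m : ℕ) (α t : ℝ) : ℕ := floorLeft (m * t / α)

/-- `h` is a bijection from `(1, ∞)` onto `(0, ∞)`, so that `wellnerHInv` is its inverse there. -/
theorem bijOn_wellnerH : Set.BijOn wellnerH (Set.Ioi 1) (Set.Ioi 0) := by
  have hcont : ContinuousOn wellnerH (Set.Ici 1) := by
    intro x hx
    have hx' : x ≠ 0 := (lt_of_lt_of_le one_pos hx).ne'
    have : ContinuousAt wellnerH x := by
      unfold wellnerH
      exact (continuousAt_id.mul ((Real.continuousAt_log hx').sub continuousAt_const)).add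
        continuousAt_const
    exact this.continuousWithinAt
  have hmono : StrictMonoOn wellnerH (Set.Ici 1) := by
    apply strictMonoOn_of_deriv_pos (convex_Ici 1) hcont
    intro x hx
    rw [interior_Ici, Set.mem_Ioi] at hx
    have hx' : x ≠ 0 := (lt_trans one_pos hx).ne'
    have hd : HasDerivAt wellnerH (1 * (Real.log x - 1) + x * x⁻¹) x :=
      ((hasDerivAt_id x).mul ((Real.hasDerivAt_log hx').sub_const 1)).add_const 1
    rw [hd.deriv, mul_inv_cancel₀ hx']
    have := Real.log_pos hx
    linarith
  have h1 : wellnerH 1 = 0 := by simp [wellnerH]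
  refine ⟨?_, (hmono.mono Set.Ioi_subset_Ici_self).injOn, ?_⟩
  · intro x hx
    have := hmono (Set.mem_Ici.2 le_rfl) (Set.Ioi_subset_Ici_self hx) hx
    rwa [h1] at this
  · intro y hy
    have hy' : (0 : ℝ) < y := hy
    have he : (1 : ℝ) ≤ Real.exp (y + 1) := Real.one_le_exp (by linarith)
    have hle : y ≤ wellnerH (Real.exp (y + 1)) := by
      have h2 : wellnerH (Real.exp (y + 1)) = Real.exp (y + 1) * y + 1 := by
        simp [wellnerH]
      rw [h2]
      nlinarith
    obtain ⟨x, hx, rfl⟩ := intermediate_value_Icc he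
      (hcont.mono Set.Icc_subset_Ici_self) ⟨by rw [h1]; exact hy'.le, hle⟩
    refine ⟨x, lt_of_le_of_ne hx.1 ?_, rfl⟩
    rintro rfl
    exact hy'.ne' h1

/-- For `t > 0`, `⌊t⁻⌋ = ⌈t⌉ - 1`. -/
theorem floorLeft_eq {t : ℝ} (ht : 0 < t) : (floorLeft t : ℤ) = ⌈t⌉ - 1 := by
  have hc : 0 < ⌈t⌉ := Int.ceil_pos.2 ht
  have key : floorLeft t = (⌈t⌉ - 1).toNat := by
    unfold floorLeft
    apply leftLim_eq_of_tendsto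
    apply Filter.Tendsto.congr' _ tendsto_const_nhds
    have hlt : ((⌈t⌉ - 1 : ℤ) : ℝ) < t := by
      have := Int.ceil_lt_add_one t
      push_cast; linarith
    filter_upwards [Ioo_mem_nhdsLT hlt] with s hs
    have hf : ⌊s⌋ = ⌈t⌉ - 1 := by
      rw [Int.floor_eq_iff]
      refine ⟨hs.1.le, ?_⟩
      have := Int.le_ceil t
      have := hs.2
      push_cast; linarith
    rw [← hf, Int.floor_toNat]
  rw [key, Int.toNat_of_nonneg (by omega)]

end MultipleTesting

open MultipleTesting

-- Let `N(t)` count the true null `p`-values that are at most `t`. These `p`-values are almost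
-- surely positive, so `|R_k ∩ H₀| > ζ_k` forces `N(t) > f(t)` at the time `t = p_(k) > 0`; the
-- truncation at `k` is harmless because `|R_k| = k` (`JER_topKFamily_le`). Each claim thus becomes
-- a boundary-crossing bound for `N` on `(0, 1]`. Crossing is favoured by small `p`-values, so a
-- quantile coupling reduces it to an i.i.d. uniform sample (`pi_le_pi_uniform`).
--
-- For `n` uniforms everything rests on `pi_uniform_crossing_le`, in effect Doob's inequality for
-- the reverse-time martingale `(1 + d/t)^N(t)`. It is proved by a change of measure: add mass `d`
-- at the origin to the uniform law. Seen only through `max t`, the product of these enlarged laws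
-- has density `(1 + d/t)^N(t)`. Splitting by the last crossing time, where this density is at least
-- `K`, gives `P(no crossing) + K P(crossing) ≤ (1 + d)^n`, the total mass.
--
-- What remains is the choice of `d`. DKW needs one `d` that works at every crossing point of the
-- line (`exists_dkw_scale`). Simes lets `d → 0`. Wellner takes `d = s (l - 1)` for times after `s`,
-- followed by a union bound over dyadic blocks.

namespace MultipleTesting

-- Calculus behind the DKW exponent

/-- At the scale `d = 6 e / (3 - 4 e)`, the derivative in `e` of the exponent gain
`y log((y - e + d) / (y - e)) - log(1 + d) - 2 e²` is nonnegative. -/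
theorem dkw_deriv_nonneg {y e : ℝ} (he : 0 < e) (he' : e ≤ 2 / 3) (hey : e < y) (hy : y ≤ 1) :
    0 ≤ 6 * y * (3 * y - 4 * e ^ 2) / ((3 - 4 * e) * (y - e) *
      (3 * y - 4 * e * y + 3 * e + 4 * e ^ 2)) - 18 / ((3 - 4 * e) * (3 + 2 * e)) - 4 * e := by
  have h1 : 0 < 3 - 4 * e := by linarith
  have h2 : 0 < y - e := by linarith
  have h3 : 0 < 3 * y - 4 * e * y + 3 * e + 4 * e ^ 2 := by nlinarith
  -- The numerator of the derivative is `2 e²` times a quadratic in `y`; this says that the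
  -- quadratic has nonpositive discriminant.
  have hdisc : 0 ≤ 4 * (108 - 64 * e ^ 2) *
      (27 + 90 * e + 36 * e ^ 2 - 96 * e ^ 3 - 64 * e ^ 4) -
      (108 + 168 * e - 96 * e ^ 2 - 128 * e ^ 3) ^ 2 := by
    have : 4 * (108 - 64 * e ^ 2) * (27 + 90 * e + 36 * e ^ 2 - 96 * e ^ 3 - 64 * e ^ 4) -
      (108 + 168 * e - 96 * e ^ 2 - 128 * e ^ 3) ^ 2 =
      e * (2592 + 1152 * e - 4608 * e ^ 2 - 3072 * e ^ 3) := by ring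
    rw [this]
    apply mul_nonneg he.le
    nlinarith [mul_nonneg he.le (sub_nonneg.2 he'), mul_nonneg (sq_nonneg e) (sub_nonneg.2 he')]
  have hA : 0 < 108 - 64 * e ^ 2 := by nlinarith
  have hq : 0 ≤ (108 - 64 * e ^ 2) * y ^ 2 - (108 + 168 * e - 96 * e ^ 2 - 128 * e ^ 3) * y +
      (27 + 90 * e + 36 * e ^ 2 - 96 * e ^ 3 - 64 * e ^ 4) := by
    have h := sq_nonneg (2 * (108 - 64 * e ^ 2) * y - (108 + 168 * e - 96 * e ^ 2 - 128 * e ^ 3))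
    by_contra hn
    push Not at hn
    have := mul_neg_of_pos_of_neg (mul_pos four_pos hA) hn
    nlinarith
  have key : 6 * y * (3 * y - 4 * e ^ 2) / ((3 - 4 * e) * (y - e) *
      (3 * y - 4 * e * y + 3 * e + 4 * e ^ 2)) - 18 / ((3 - 4 * e) * (3 + 2 * e)) - 4 * e =
      2 * e ^ 2 * ((108 - 64 * e ^ 2) * y ^ 2 - (108 + 168 * e - 96 * e ^ 2 - 128 * e ^ 3) * y +
      (27 + 90 * e + 36 * e ^ 2 - 96 * e ^ 3 - 64 * e ^ 4)) /
      ((3 - 4 * e) * (y - e) * (3 * y - 4 * e * y + 3 * e + 4 * e ^ 2) * (3 + 2 * e)) := by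
    have h4 : 3 + 2 * e ≠ 0 := by positivity
    have h1' := h1.ne'
    have h2' := h2.ne'
    have h3' := h3.ne'
    obtain ⟨D, hD⟩ : ∃ D, D = 3 * y - 4 * e * y + 3 * e + 4 * e ^ 2 := ⟨_, rfl⟩
    rw [← hD] at h3' ⊢
    field_simp
    rw [hD]
    ring
  rw [key]
  have h4 : 0 < 3 + 2 * e := by positivity
  positivity

/-- The exponent gain `y log((y - e + d) / (y - e)) - log(1 + d) - 2 e²` is nonnegative at the scale
`d = 6 e / (3 - 4 e)`. -/
theorem dkw_gain_nonneg_of_le {y e : ℝ} (he : 0 ≤ e) (he' : e ≤ 2 / 3) (hey : e < y) (hy : y ≤ 1) :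
    0 ≤ y * (Real.log (y - e + 6 * e / (3 - 4 * e)) - Real.log (y - e)) -
      Real.log (1 + 6 * e / (3 - 4 * e)) - 2 * e ^ 2 := by
  set F : ℝ → ℝ := fun x => y * (Real.log (y - x + 6 * x / (3 - 4 * x)) - Real.log (y - x)) -
      Real.log (1 + 6 * x / (3 - 4 * x)) - 2 * x ^ 2 with hF
  have hder : ∀ x ∈ Set.Icc 0 e, HasDerivAt F (6 * y * (3 * y - 4 * x ^ 2) / ((3 - 4 * x) *
      (y - x) * (3 * y - 4 * x * y + 3 * x + 4 * x ^ 2)) - 18 / ((3 - 4 * x) * (3 + 2 * x)) -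
      4 * x) x := by
    intro x hx
    obtain ⟨hx0, hx1⟩ := hx
    have h1 : 0 < 3 - 4 * x := by linarith
    have h2 : 0 < y - x := by linarith
    have h3 : 0 < 3 * y - 4 * x * y + 3 * x + 4 * x ^ 2 := by nlinarith
    have hr : 0 ≤ 6 * x / (3 - 4 * x) := div_nonneg (by linarith) h1.le
    have hd : HasDerivAt (fun x : ℝ => 6 * x / (3 - 4 * x)) (18 / (3 - 4 * x) ^ 2) x := by
      have := ((hasDerivAt_id x).const_mul 6).div
        (((hasDerivAt_id x).const_mul 4).const_sub 3) h1.ne'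
      refine this.congr_deriv ?_
      simp only [id]
      congr 1
      ring
    have hs : HasDerivAt (fun x : ℝ => y - x) (-1) x := by
      simpa using (hasDerivAt_id x).const_sub y
    have h := (((((hs.add hd).log (add_pos_of_pos_of_nonneg h2 hr).ne').sub
      (hs.log h2.ne')).const_mul y).sub
      ((hd.const_add 1).log (add_pos_of_pos_of_nonneg one_pos hr).ne')).sub
      (((hasDerivAt_id x).pow 2).const_mul 2)
    refine h.congr_deriv ?_
    have h1' := h1.ne'
    have h2' := h2.ne'
    have h3' := h3.ne'
    have e1 : y - x + 6 * x / (3 - 4 * x) =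
        (3 * y - 4 * x * y + 3 * x + 4 * x ^ 2) / (3 - 4 * x) := by
      rw [eq_div_iff h1', add_mul, div_mul_cancel₀ _ h1']; ring
    have e2 : 1 + 6 * x / (3 - 4 * x) = (3 + 2 * x) / (3 - 4 * x) := by
      rw [eq_div_iff h1', add_mul, div_mul_cancel₀ _ h1']; ring
    have h4 : 3 + 2 * x ≠ 0 := by positivity
    simp only [Pi.add_apply, id, e1, e2]
    obtain ⟨D, hD⟩ : ∃ D, D = 3 * y - 4 * x * y + 3 * x + 4 * x ^ 2 := ⟨_, rfl⟩
    rw [← hD] at h3' ⊢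
    field_simp
    rw [hD]
    ring
  have hmono : MonotoneOn F (Set.Icc 0 e) := by
    apply monotoneOn_of_hasDerivWithinAt_nonneg (convex_Icc 0 e)
      (fun x hx => (hder x hx).continuousAt.continuousWithinAt)
      (fun x hx => (hder x (interior_subset hx)).hasDerivWithinAt)
    intro x hx
    rw [interior_Icc] at hx
    exact dkw_deriv_nonneg hx.1 (by linarith [hx.2]) (by linarith [hx.2]) hy
  have := hmono ⟨le_rfl, he⟩ ⟨he, le_rfl⟩ he
  have h0 : F 0 = 0 := by simp [hF]
  rwa [h0] at this

/-- For deviations above `2/3`, the fixed scale `d = 12` suffices. -/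
theorem dkw_gain_nonneg_of_ge {y e : ℝ} (he : 2 / 3 ≤ e) (hey : e < y) (hy : y ≤ 1) :
    0 ≤ y * (Real.log (y - e + 12) - Real.log (y - e)) - Real.log (1 + 12) - 2 * e ^ 2 := by
  set F : ℝ → ℝ := fun x => y * (Real.log (y - x + 12) - Real.log (y - x)) -
      Real.log (1 + 12) - 2 * x ^ 2 with hF
  have hder : ∀ x ∈ Set.Icc (2 / 3) e, HasDerivAt F (y * 12 / ((y - x) * (y - x + 12)) -
      4 * x) x := by
    intro x hx
    obtain ⟨hx0, hx1⟩ := hx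
    have h2 : 0 < y - x := by linarith
    have h3 : 0 < y - x + 12 := by linarith
    have hs : HasDerivAt (fun x : ℝ => y - x) (-1) x := by
      simpa using (hasDerivAt_id x).const_sub y
    have h := (((((hs.add_const 12).log h3.ne').sub (hs.log h2.ne')).const_mul y).sub_const
      (Real.log (1 + 12))).sub (((hasDerivAt_id x).pow 2).const_mul 2)
    refine h.congr_deriv ?_
    simp only [id]
    field_simp
    ring
  have hmono : MonotoneOn F (Set.Icc (2 / 3) e) := by
    apply monotoneOn_of_hasDerivWithinAt_nonneg (convex_Icc _ e)
      (fun x hx => (hder x hx).continuousAt.continuousWithinAt)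
      (fun x hx => (hder x (interior_subset hx)).hasDerivWithinAt)
    intro x hx
    rw [interior_Icc] at hx
    obtain ⟨hx0, hx1⟩ := hx
    have h2 : 0 < y - x := by linarith
    rw [sub_nonneg, le_div_iff₀ (by positivity)]
    -- Since `x > 2/3` and `y ≤ 1`, the gap `y - x` is below `1/3`.
    have h4 : (y - x) * (y - x + 12) ≤ (y - x) * (37 / 3) :=
      mul_le_mul_of_nonneg_left (by linarith) h2.le
    have h5 : 4 * x * ((y - x) * (y - x + 12)) ≤ 4 * x * ((y - x) * (37 / 3)) :=
      mul_le_mul_of_nonneg_left h4 (by linarith)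
    nlinarith
  have h1 := hmono ⟨le_rfl, he⟩ ⟨he, le_rfl⟩ he
  -- At `e = 2/3` the scale `6 e / (3 - 4 e)` equals `12`, so the two regimes agree there.
  have h0 := dkw_gain_nonneg_of_le (y := y) (e := 2 / 3) (by norm_num) le_rfl (by linarith) hy
  norm_num at h0
  refine le_trans ?_ h1
  simp only [hF]
  norm_num
  linarith

/-- For every deviation `e < 1` there is an exponential scale `d` that certifies the sub-Gaussian
bound `exp(-2 n e²)` simultaneously at all crossing points. -/
theorem exists_dkw_scale {e : ℝ} (he : 0 < e) (he1 : e < 1) :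
    ∃ d : ℝ, 0 < d ∧ ∀ t, 0 < t → t + e ≤ 1 →
      Real.log (1 + d) + 2 * e ^ 2 ≤ (t + e) * Real.log (1 + d / t) := by
  have hlog : ∀ t d : ℝ, 0 < t → 0 < d →
      Real.log (1 + d / t) = Real.log (t + e - e + d) - Real.log (t + e - e) := by
    intro t d ht hd
    rw [add_sub_cancel_right, ← Real.log_div (by positivity) ht.ne']
    congr 1
    field_simp
  rcases le_total e (2 / 3) with h | h
  · have hd : 0 < 6 * e / (3 - 4 * e) := div_pos (by linarith) (by linarith)
    refine ⟨_, hd, fun t ht hte => ?_⟩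
    rw [hlog t _ ht hd]
    linarith [dkw_gain_nonneg_of_le (y := t + e) he.le h (by linarith) hte]
  · refine ⟨12, by norm_num, fun t ht hte => ?_⟩
    rw [hlog t _ ht (by norm_num)]
    linarith [dkw_gain_nonneg_of_ge (y := t + e) h (by linarith) hte]

-- The uniform law and counting processes

/-- The uniform distribution on `(0, 1)`. -/
noncomputable def uniform : Measure ℝ := volume.restrict (Set.Ioo 0 1)

instance : IsProbabilityMeasure uniform := ⟨by simp [uniform]⟩

theorem uniform_Iic {t : ℝ} (ht1 : t ≤ 1) : uniform (Set.Iic t) = ENNReal.ofReal t := by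
  rw [uniform, restrict_Ioo_eq_restrict_Ioc, Measure.restrict_apply measurableSet_Iic,
    Set.inter_comm, Set.Ioc_inter_Iic, min_eq_right ht1, Real.volume_Ioc, sub_zero]

/-- The number of coordinates of `x` that are at most `t`. -/
noncomputable def countLE {ι : Type*} [Fintype ι] (x : ι → ℝ) (t : ℝ) : ℕ :=
  (Finset.univ.filter fun i => x i ≤ t).card

section CountLE

variable {ι : Type*} [Fintype ι]

theorem countLE_le_card (x : ι → ℝ) (t : ℝ) : countLE x t ≤ Fintype.card ι :=
  Finset.card_le_univ _

theorem countLE_mono (x : ι → ℝ) {s t : ℝ} (h : s ≤ t) : countLE x s ≤ countLE x t :=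
  Finset.card_le_card fun i hi => by
    simp only [Finset.mem_filter, Finset.mem_univ, true_and] at hi ⊢
    exact hi.trans h

theorem countLE_anti {x y : ι → ℝ} (h : x ≤ y) (t : ℝ) : countLE y t ≤ countLE x t :=
  Finset.card_le_card fun i hi => by
    simp only [Finset.mem_filter, Finset.mem_univ, true_and] at hi ⊢
    exact (h i).trans hi

/-- Raising coordinates to `s` cannot carry any of them across a later level `t`; hence events about
counts after `s` are determined by what is observed above `s`. -/
theorem countLE_max (x : ι → ℝ) {s t : ℝ} (h : s ≤ t) :
    countLE (fun i => max s (x i)) t = countLE x t := by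
  unfold countLE
  congr 1
  ext i
  simp [h]

theorem measurable_countLE (t : ℝ) : Measurable fun x : ι → ℝ => countLE x t := by
  simp only [countLE, Finset.card_filter]
  refine Finset.measurable_sum _ fun i _ => Measurable.ite ?_ measurable_const measurable_const
  exact measurableSet_le (measurable_pi_apply i) measurable_const

end CountLE

-- Change of measure

/-- A product of measures with densities has the product density. -/
theorem pi_withDensity_prod {ι : Type*} [Fintype ι] (μ : Measure ℝ) [IsProbabilityMeasure μ]
    {f : ℝ → ENNReal} (hf : Measurable f) [SigmaFinite (μ.withDensity f)] :
    Measure.pi (fun _ : ι => μ.withDensity f) =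
      (Measure.pi fun _ : ι => μ).withDensity fun x => ∏ i, f (x i) := by
  refine Measure.pi_eq fun s hs => ?_
  rw [withDensity_apply _ (MeasurableSet.univ_pi hs),
    ← lintegral_indicator (MeasurableSet.univ_pi hs)]
  have hind : ∀ x : ι → ℝ, (Set.univ.pi s).indicator (fun x => ∏ i, f (x i)) x =
      ∏ i, (s i).indicator f (x i) := by
    intro x
    by_cases hx : x ∈ Set.univ.pi s
    · rw [Set.indicator_of_mem hx]
      exact Finset.prod_congr rfl fun i _ => (Set.indicator_of_mem (hx i trivial) f).symm
    · rw [Set.indicator_of_notMem hx]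
      simp only [Set.mem_pi, Set.mem_univ, true_implies, not_forall] at hx
      obtain ⟨i, hi⟩ := hx
      exact (Finset.prod_eq_zero (Finset.mem_univ i) (Set.indicator_of_notMem hi f)).symm
  simp only [hind]
  have hm : ∀ i, Measurable ((s i).indicator f) := fun i => hf.indicator (hs i)
  have hi : iIndepFun (fun i (x : ι → ℝ) => (s i).indicator f (x i)) (Measure.pi fun _ : ι => μ) :=
    iIndepFun_pi fun i => (hm i).aemeasurable
  rw [lintegral_prod_eq_prod_lintegral_of_indepFun _ _ hi
    fun i => (hm i).comp (measurable_pi_apply i)]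
  refine Finset.prod_congr rfl fun i _ => ?_
  rw [withDensity_apply _ (hs i), ← lintegral_indicator (hs i)]
  exact (measurePreserving_eval (fun _ : ι => μ) i).lintegral_comp (hm i)

/-- The density `1 + (d / t) 1{u ≤ t}`: on what is observed of `u` above `t`, reweighting the uniform
law by it amounts to adding mass `d` at the origin. -/
noncomputable def tilt (d t u : ℝ) : ENNReal :=
  1 + (Set.Iic t).indicator (fun _ => ENNReal.ofReal (d / t)) u

theorem measurable_tilt (d t : ℝ) : Measurable (tilt d t) :=
  (measurable_const (a := (1 : ENNReal))).add (measurable_const.indicator measurableSet_Iic)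

theorem uniform_withDensity_tilt (d t : ℝ) : uniform.withDensity (tilt d t) =
    uniform + ENNReal.ofReal (d / t) • uniform.restrict (Set.Iic t) := by
  have : tilt d t = 1 + (Set.Iic t).indicator (fun _ => ENNReal.ofReal (d / t)) := rfl
  rw [this, withDensity_add_left measurable_one, withDensity_one,
    withDensity_indicator measurableSet_Iic, withDensity_const]

instance (d t : ℝ) : IsFiniteMeasure (uniform.withDensity (tilt d t)) := by
  rw [uniform_withDensity_tilt]
  have : IsFiniteMeasure (ENNReal.ofReal (d / t) • uniform.restrict (Set.Iic t)) :=
    Measure.smul_finite _ ENNReal.ofReal_ne_top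
  infer_instance

/-- The uniform law with an additional mass `d` at the origin. -/
noncomputable def uniformAtom (d : ℝ) : Measure ℝ := uniform + ENNReal.ofReal d • Measure.dirac 0

instance (d : ℝ) : IsFiniteMeasure (uniformAtom d) := by
  have : IsFiniteMeasure (ENNReal.ofReal d • Measure.dirac (0 : ℝ)) :=
    Measure.smul_finite _ ENNReal.ofReal_ne_top
  unfold uniformAtom
  infer_instance

theorem uniformAtom_univ {d : ℝ} (hd : 0 ≤ d) :
    uniformAtom d Set.univ = ENNReal.ofReal (1 + d) := by
  simp [uniformAtom, ENNReal.ofReal_add zero_le_one hd]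

/-- The map `max t` collapses `(0, t]` and the origin to the single point `t`. The extra mass that
the tilt spreads over `(0, t]` is `(d / t) · t = d`, exactly that of the atom. -/
theorem map_max_tilt {d t : ℝ} (hd : 0 ≤ d) (ht : 0 < t) (ht1 : t ≤ 1) :
    (uniform.withDensity (tilt d t)).map (max t) = (uniformAtom d).map (max t) := by
  have hm : Measurable (max t) := measurable_const.max measurable_id
  rw [uniform_withDensity_tilt, uniformAtom, Measure.map_add _ _ hm, Measure.map_add _ _ hm]
  congr 1
  rw [Measure.map_smul, Measure.map_smul, Measure.map_dirac' hm, max_eq_left ht.le]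
  have h : (max t) =ᵐ[uniform.restrict (Set.Iic t)] fun _ => t := by
    filter_upwards [ae_restrict_mem measurableSet_Iic] with u hu using max_eq_left hu
  rw [Measure.map_congr h, Measure.map_const, Measure.restrict_apply MeasurableSet.univ,
    Set.univ_inter, uniform_Iic ht1, smul_smul,
    ← ENNReal.ofReal_mul (div_nonneg hd ht.le), div_mul_cancel₀ _ ht.ne']

/-- Change of measure for an event `B` that depends on the sample only through what is observed
above the time `t`. -/
theorem pi_uniform_le_pi_uniformAtom {ι : Type*} [Fintype ι] {d t K : ℝ} (hd : 0 ≤ d) (ht : 0 < t)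
    (ht1 : t ≤ 1) {B : Set (ι → ℝ)} (hB : MeasurableSet B)
    (hinv : ∀ x, (fun i => max t (x i)) ∈ B ↔ x ∈ B)
    (hK : ∀ x ∈ B, K ≤ (1 + d / t) ^ countLE x t) :
    ENNReal.ofReal K * Measure.pi (fun _ : ι => uniform) B ≤
      Measure.pi (fun _ : ι => uniformAtom d) B := by
  have hm : Measurable (max t) := measurable_const.max measurable_id
  have hmap : ∀ ν : Measure ℝ, IsFiniteMeasure ν → Measure.pi (fun _ : ι => ν) B =
      Measure.pi (fun _ : ι => ν.map (max t)) B := by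
    intro ν hν
    rw [← Measure.pi_map_pi fun _ => hm.aemeasurable, Measure.map_apply (by fun_prop) hB]
    congr 1
    ext x
    exact (hinv x).symm
  rw [hmap (uniformAtom d) inferInstance, ← map_max_tilt hd ht ht1, ← hmap _ inferInstance,
    pi_withDensity_prod _ (measurable_tilt d t), withDensity_apply _ hB,
    ← setLIntegral_const]
  refine setLIntegral_mono' hB fun x hx => ?_
  have : ∏ i, tilt d t (x i) = ENNReal.ofReal ((1 + d / t) ^ countLE x t) := by
    have hdt : 0 ≤ d / t := div_nonneg hd ht.le
    rw [ENNReal.ofReal_pow (by positivity), ENNReal.ofReal_add zero_le_one hdt, ENNReal.ofReal_one]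
    have h : ∀ i, tilt d t (x i) = if x i ≤ t then 1 + ENNReal.ofReal (d / t) else 1 := by
      intro i
      by_cases hi : x i ≤ t <;> simp [tilt, hi]
    simp only [h, Finset.prod_ite, Finset.prod_const, one_pow, mul_one]
    rfl
  rw [this]
  exact ENNReal.ofReal_le_ofReal (hK x hx)

-- Maximal inequality for a uniform sample

/-- The event that the counting process of `x` exceeds the threshold `r` at some time of `S`. -/
def crossing {ι : Type*} [Fintype ι] (S : Finset ℝ) (r : ℝ → ℝ) : Set (ι → ℝ) :=
  {x | ∃ t ∈ S, r t ≤ countLE x t}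

section Crossing

variable {ι : Type*} [Fintype ι]

/-- The event that `t` is the last time of `S` at which the threshold is exceeded. -/
def lastCrossing (S : Finset ℝ) (r : ℝ → ℝ) (t : ℝ) : Set (ι → ℝ) :=
  {x | r t ≤ countLE x t ∧ ∀ t' ∈ S, t < t' → (countLE x t' : ℝ) < r t'}

theorem measurableSet_le_countLE (c t : ℝ) : MeasurableSet {x : ι → ℝ | c ≤ countLE x t} :=
  measurableSet_le measurable_const ((measurable_of_countable _).comp (measurable_countLE t))

theorem measurableSet_crossing (S : Finset ℝ) (r : ℝ → ℝ) :
    MeasurableSet (crossing S r : Set (ι → ℝ)) := by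
  have : (crossing S r : Set (ι → ℝ)) = ⋃ t ∈ S, {x | r t ≤ countLE x t} := by
    ext x; simp [crossing]
  rw [this]
  exact S.measurableSet_biUnion fun t _ => measurableSet_le_countLE _ _

theorem measurableSet_lastCrossing (S : Finset ℝ) (r : ℝ → ℝ) (t : ℝ) :
    MeasurableSet (lastCrossing S r t : Set (ι → ℝ)) := by
  have : (lastCrossing S r t : Set (ι → ℝ)) =
      {x | r t ≤ countLE x t} ∩ (crossing (S.filter (t < ·)) r)ᶜ := by
    ext x
    simp [lastCrossing, crossing]
  rw [this]
  exact (measurableSet_le_countLE _ _).inter (measurableSet_crossing _ _).compl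

theorem crossing_eq_biUnion (S : Finset ℝ) (r : ℝ → ℝ) :
    (crossing S r : Set (ι → ℝ)) = ⋃ t ∈ S, lastCrossing S r t := by
  ext x
  simp only [crossing, lastCrossing, Set.mem_ofPred_eq, Set.mem_iUnion, exists_prop]
  constructor
  · rintro ⟨t, ht, h⟩
    obtain ⟨s, hs, hmax⟩ := (S.filter fun t => r t ≤ countLE x t).exists_max_image id
      ⟨t, Finset.mem_filter.2 ⟨ht, h⟩⟩
    rw [Finset.mem_filter] at hs
    refine ⟨s, hs.1, hs.2, fun t' ht' hlt => ?_⟩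
    by_contra hn
    exact absurd (hmax t' (Finset.mem_filter.2 ⟨ht', not_lt.1 hn⟩)) (not_le.2 hlt)
  · rintro ⟨t, ht, h, -⟩
    exact ⟨t, ht, h⟩

theorem pairwiseDisjoint_lastCrossing (S : Finset ℝ) (r : ℝ → ℝ) :
    (S : Set ℝ).PairwiseDisjoint (lastCrossing S r : ℝ → Set (ι → ℝ)) := by
  intro s hs t ht hne
  refine Set.disjoint_left.2 fun x hx hy => ?_
  rcases lt_or_gt_of_ne hne with h | h
  · exact absurd (hx.2 t ht h) (not_lt.2 hy.1)
  · exact absurd (hy.2 s hs h) (not_lt.2 hx.1)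

/-- Only counts at times `≥ t` enter. This is why crossings are classified by the last time rather
than the first: the change of measure at `t` needs this invariance. -/
theorem max_mem_lastCrossing_iff (S : Finset ℝ) (r : ℝ → ℝ) (t : ℝ) (x : ι → ℝ) :
    (fun i => max t (x i)) ∈ lastCrossing S r t ↔ x ∈ lastCrossing S r t := by
  simp only [lastCrossing, Set.mem_ofPred_eq, countLE_max x le_rfl]
  refine and_congr_right fun _ => forall₃_congr fun t' _ ht' => ?_
  rw [countLE_max x ht'.le]

/-- Maximal inequality for the counting process of a uniform sample. -/
theorem pi_uniform_crossing_le {d K : ℝ} (hd : 0 ≤ d) (S : Finset ℝ) (r : ℝ → ℝ)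
    (hS : ∀ t ∈ S, 0 < t ∧ t ≤ 1)
    (hK : ∀ t ∈ S, ∀ k : ℕ, r t ≤ k → k ≤ Fintype.card ι → K ≤ (1 + d / t) ^ k) :
    Measure.pi (fun _ : ι => uniform) (crossing S r)ᶜ +
      ENNReal.ofReal K * Measure.pi (fun _ : ι => uniform) (crossing S r) ≤
      ENNReal.ofReal ((1 + d) ^ Fintype.card ι) := by
  have hE : MeasurableSet (crossing S r : Set (ι → ℝ)) := measurableSet_crossing S r
  have htot : Measure.pi (fun _ : ι => uniformAtom d) Set.univ =
      ENNReal.ofReal ((1 + d) ^ Fintype.card ι) := by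
    rw [Measure.pi_univ]
    simp [uniformAtom_univ hd, ENNReal.ofReal_pow (by positivity : 0 ≤ 1 + d)]
  rw [← htot, ← measure_add_measure_compl hE, add_comm (Measure.pi _ (crossing S r))]
  refine add_le_add ?_ ?_
  · rw [← one_mul (Measure.pi (fun _ : ι => uniform) (crossing S r)ᶜ), ← ENNReal.ofReal_one]
    -- Without a crossing the constant is `1`. The event depends only on counts from the earliest
    -- time of `S` on, so the comparison is made there; if `S` is empty, time `1` serves.
    rcases S.eq_empty_or_nonempty with rfl | hne
    · refine pi_uniform_le_pi_uniformAtom hd one_pos le_rfl hE.compl (fun x => ?_)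
        fun x _ => one_le_pow₀ (by simpa using hd)
      simp [crossing]
    · have hmin := hS _ (S.min'_mem hne)
      refine pi_uniform_le_pi_uniformAtom hd hmin.1 hmin.2 hE.compl (fun x => ?_)
        fun x _ => one_le_pow₀ (by have := div_nonneg hd hmin.1.le; linarith)
      refine not_congr (exists_congr fun t => and_congr_right fun ht => ?_)
      rw [countLE_max x (S.min'_le t ht)]
  -- The comparison uses a different density for each last crossing time, but always the same
  -- enlarged measure, so the disjoint pieces add up.
  · rw [crossing_eq_biUnion, measure_biUnion_finset (pairwiseDisjoint_lastCrossing S r)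
      fun t _ => measurableSet_lastCrossing S r t,
      measure_biUnion_finset (pairwiseDisjoint_lastCrossing S r)
      fun t _ => measurableSet_lastCrossing S r t, Finset.mul_sum]
    refine Finset.sum_le_sum fun t ht => ?_
    exact pi_uniform_le_pi_uniformAtom hd (hS t ht).1 (hS t ht).2
      (measurableSet_lastCrossing S r t) (max_mem_lastCrossing_iff S r t)
      fun x hx => hK t ht _ hx.1 (countLE_le_card x t)

end Crossing

-- Reduction of super-uniform laws to the uniform law

/-- Quantile coupling: a super-uniform law is the image of the uniform law under a map that lies
above the identity. -/
theorem exists_quantile_coupling (ν : Measure ℝ) [IsProbabilityMeasure ν]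
    (h : ∀ x, ν.real (Set.Iic x) ≤ max 0 (min x 1)) :
    ∃ q : ℝ → ℝ, AEMeasurable q uniform ∧ uniform.map q = ν ∧ ∀ᵐ u ∂uniform, u ≤ q u := by
  have hne : ∀ u ∈ Set.Ioo (0 : ℝ) 1, {x | u ≤ cdf ν x}.Nonempty := fun u hu =>
    (((tendsto_cdf_atTop ν).eventually (lt_mem_nhds hu.2)).exists).imp fun _ hx => hx.le
  -- Super-uniformity enters here. The bound makes the infimum defining the quantile meaningful, and
  -- also gives `u ≤ q u`.
  have hlb : ∀ u ∈ Set.Ioo (0 : ℝ) 1, ∀ x ∈ {x | u ≤ cdf ν x}, u ≤ x := by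
    intro u hu x hx
    have h1 : u ≤ max 0 (min x 1) := le_trans hx ((cdf_eq_real ν x).trans_le (h x))
    rcases le_max_iff.1 h1 with h2 | h2
    · exact absurd hu.1 (not_lt.2 h2)
    · exact h2.trans (min_le_left _ _)
  set q : ℝ → ℝ := fun u => sInf {x | u ≤ cdf ν x} with hq
  -- Galois connection between quantile function and cdf; right continuity of the cdf gives the
  -- forward direction.
  have hgc : ∀ u ∈ Set.Ioo (0 : ℝ) 1, ∀ x, q u ≤ x ↔ u ≤ cdf ν x := by
    intro u hu x
    constructor
    · intro hx
      have hr : Filter.Tendsto (cdf ν) (nhdsWithin x (Set.Ioi x)) (nhds (cdf ν x)) :=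
        ((cdf ν).right_continuous x).tendsto.mono_left
          (nhdsWithin_mono _ Set.Ioi_subset_Ici_self)
      refine ge_of_tendsto hr ?_
      filter_upwards [self_mem_nhdsWithin] with y hy
      obtain ⟨z, hz, hzy⟩ := exists_lt_of_csInf_lt (hne u hu) (lt_of_le_of_lt hx hy)
      exact le_trans hz (monotone_cdf ν hzy.le)
    · intro hx
      exact csInf_le ⟨u, hlb u hu⟩ hx
  have hmono : MonotoneOn q (Set.Ioo 0 1) := by
    intro u hu v hv huv
    rw [hgc u hu]
    exact huv.trans ((hgc v hv _).1 le_rfl)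
  have hqm : AEMeasurable q uniform := aemeasurable_restrict_of_monotoneOn measurableSet_Ioo hmono
  have hmem : ∀ᵐ u ∂uniform, u ∈ Set.Ioo (0 : ℝ) 1 := ae_restrict_mem measurableSet_Ioo
  refine ⟨q, hqm, ?_, ?_⟩
  · have := Measure.isProbabilityMeasure_map hqm
    refine Measure.ext_of_Iic _ _ fun x => ?_
    rw [Measure.map_apply_of_aemeasurable hqm measurableSet_Iic, ← ofReal_cdf ν x,
      ← uniform_Iic (cdf_le_one ν x)]
    refine measure_congr ?_
    filter_upwards [hmem] with u hu
    exact propext (hgc u hu x)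
  · filter_upwards [hmem] with u hu
    exact le_csInf (hne u hu) (hlb u hu)

/-- Among products of super-uniform laws, the uniform one gives the largest probability to lower
sets. -/
theorem pi_le_pi_uniform {ι : Type*} [Fintype ι] (ν : ι → Measure ℝ)
    [∀ i, IsProbabilityMeasure (ν i)] (h : ∀ i x, (ν i).real (Set.Iic x) ≤ max 0 (min x 1))
    {B : Set (ι → ℝ)} (hB : MeasurableSet B) (hlow : IsLowerSet B) :
    Measure.pi ν B ≤ Measure.pi (fun _ : ι => uniform) B := by
  choose q hqm hqν hq using fun i => exists_quantile_coupling (ν i) (h i)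
  have hν : ν = fun i => uniform.map (q i) := funext fun i => (hqν i).symm
  have hm : AEMeasurable (fun (x : ι → ℝ) i => q i (x i)) (Measure.pi fun _ => uniform) :=
    aemeasurable_pi_iff.2 fun i =>
      (hqm i).comp_quasiMeasurePreserving (Measure.quasiMeasurePreserving_eval _ i)
  have : ∀ i, IsProbabilityMeasure (uniform.map (q i)) := fun i =>
    Measure.isProbabilityMeasure_map (hqm i)
  rw [hν, ← Measure.pi_map_pi hqm, Measure.map_apply_of_aemeasurable hm hB]
  -- The coupled sample dominates the uniform one coordinatewise, so whenever it lies in the lower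
  -- set, so does the uniform sample.
  refine measure_mono_ae ?_
  filter_upwards [Measure.ae_le_pi (f := fun _ u => u) (f' := q) fun i => hq i] with x hx
  exact hlow hx

/-- Lowering coordinates can only increase the counts; this makes `pi_le_pi_uniform` applicable to
crossings. -/
theorem isLowerSet_crossing {ι : Type*} [Fintype ι] (S : Finset ℝ) (r : ℝ → ℝ) :
    IsLowerSet (crossing S r : Set (ι → ℝ)) := by
  rintro x y hyx ⟨t, ht, h⟩
  exact ⟨t, ht, h.trans (Nat.cast_le.2 (countLE_anti hyx t))⟩

-- Maximal inequalities for independent super-uniform variables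

/-- The random variables `Y i` are independent and super-uniform under `P`. -/
structure IndepSuperUniform {Ω ι : Type*} [MeasurableSpace Ω] (P : Measure Ω) (Y : ι → Ω → ℝ) :
    Prop where
  aemeasurable : ∀ i, AEMeasurable (Y i) P
  indep : iIndepFun Y P
  superUniform : ∀ i x, P.real {ω | Y i ω ≤ x} ≤ max 0 (min x 1)

section Maximal

variable {Ω ι : Type*} [MeasurableSpace Ω] [Fintype ι] {P : Measure Ω} [IsProbabilityMeasure P]
  {Y : ι → Ω → ℝ}

/-- Maximal inequality over finitely many times for the counting process of independent
super-uniform random variables. -/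
theorem IndepSuperUniform.one_add_mul_crossing_le (hY : IndepSuperUniform P Y) {d K : ℝ}
    (hd : 0 ≤ d) (hK1 : 1 ≤ K) (S : Finset ℝ) (r : ℝ → ℝ) (hS : ∀ t ∈ S, 0 < t ∧ t ≤ 1)
    (hK : ∀ t ∈ S, ∀ k : ℕ, r t ≤ k → k ≤ Fintype.card ι → K ≤ (1 + d / t) ^ k) :
    1 + (K - 1) * P.real {ω | ∃ t ∈ S, r t ≤ countLE (fun i => Y i ω) t} ≤
      (1 + d) ^ Fintype.card ι := by
  have hE : MeasurableSet (crossing S r : Set (ι → ℝ)) := measurableSet_crossing S r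
  have hYm : AEMeasurable (fun ω i => Y i ω) P := aemeasurable_pi_iff.2 hY.aemeasurable
  have hprob : ∀ i, IsProbabilityMeasure (P.map (Y i)) := fun i =>
    Measure.isProbabilityMeasure_map (hY.aemeasurable i)
  set p := (Measure.pi fun _ : ι => uniform).real (crossing S r) with hp
  have h1 : P.real {ω | ∃ t ∈ S, r t ≤ countLE (fun i => Y i ω) t} ≤ p := by
    refine ENNReal.toReal_mono (measure_ne_top _ _) ?_
    calc P {ω | ∃ t ∈ S, r t ≤ countLE (fun i => Y i ω) t}
        = P.map (fun ω i => Y i ω) (crossing S r) :=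
          (Measure.map_apply_of_aemeasurable hYm hE).symm
      _ = Measure.pi (fun i => P.map (Y i)) (crossing S r) := by
          rw [hY.indep.map_fun_eq_pi_map hY.aemeasurable]
      _ ≤ _ := by
          refine pi_le_pi_uniform _ (fun i x => ?_) hE (isLowerSet_crossing S r)
          rw [measureReal_def, Measure.map_apply_of_aemeasurable (hY.aemeasurable i)
            measurableSet_Iic]
          exact hY.superUniform i x
  have h2 := pi_uniform_crossing_le (ι := ι) hd S r hS hK
  have h3 : (1 - p) + K * p ≤ (1 + d) ^ Fintype.card ι := by
    have h4 := ENNReal.toReal_mono ENNReal.ofReal_ne_top h2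
    rw [ENNReal.toReal_ofReal (by positivity), ENNReal.toReal_add (measure_ne_top _ _)
      (ENNReal.mul_ne_top ENNReal.ofReal_ne_top (measure_ne_top _ _)), ENNReal.toReal_mul,
      ENNReal.toReal_ofReal (by linarith)] at h4
    rwa [← measureReal_def, ← measureReal_def, probReal_compl_eq_one_sub hE] at h4
  have := mul_le_mul_of_nonneg_left h1 (sub_nonneg.2 hK1)
  linarith

/-- Maximal inequality for the crossing of the line `t ↦ a t + b` by the counting process of
independent super-uniform random variables, after time `s`. -/
theorem IndepSuperUniform.one_add_mul_line_le (hY : IndepSuperUniform P Y) {a b s d K : ℝ}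
    (ha : 0 < a) (hab : Fintype.card ι ≤ a + b) (hd : 0 ≤ d) (hK1 : 1 ≤ K)
    (hK : ∀ (t : ℝ) (k : ℕ), 0 < t → s ≤ t → k ≤ Fintype.card ι → a * t + b = k →
      K ≤ (1 + d / t) ^ k) :
    1 + (K - 1) * P.real {ω | ∃ t, 0 < t ∧ s ≤ t ∧ a * t + b ≤ countLE (fun i => Y i ω) t} ≤
      (1 + d) ^ Fintype.card ι := by
  classical
  -- `τ k` is the time at which the line has height `k`. If the count at `t` is `k` and lies on or
  -- above the line, then `t ≤ τ k`, and by monotonicity the count is still at least `k` at `τ k`.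
  -- So finitely many times suffice; `hab` puts them below `1`.
  set τ : ℕ → ℝ := fun k => (k - b) / a with hτ
  have hτk : ∀ k : ℕ, a * τ k + b = k := fun k => by simp only [hτ]; field_simp; ring
  set S : Finset ℝ := ((Finset.range (Fintype.card ι + 1)).image τ).filter fun t =>
    0 < t ∧ s ≤ t with hS
  have hmemS : ∀ t ∈ S, ∃ k : ℕ, k ≤ Fintype.card ι ∧ τ k = t ∧ 0 < t ∧ s ≤ t ∧ t ≤ 1 := by
    intro t ht
    simp only [hS, Finset.mem_filter, Finset.mem_image, Finset.mem_range] at ht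
    obtain ⟨⟨k, hk, rfl⟩, h0, hs⟩ := ht
    refine ⟨k, by omega, rfl, h0, hs, ?_⟩
    rw [hτ, div_le_one ha]
    have : (k : ℝ) ≤ Fintype.card ι := by exact_mod_cast Nat.lt_succ_iff.1 hk
    linarith
  have hmain := hY.one_add_mul_crossing_le hd hK1 S (fun t => a * t + b)
    (fun t ht => by obtain ⟨k, -, -, h0, -, h1⟩ := hmemS t ht; exact ⟨h0, h1⟩) (by
      intro t ht k hk _
      obtain ⟨j, hj, hjt, h0, hs, -⟩ := hmemS t ht
      have hjk : j ≤ k := by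
        rw [← hjt, hτk] at hk
        exact_mod_cast hk
      refine (hK t j h0 hs hj (by rw [← hjt, hτk])).trans (pow_le_pow_right₀ ?_ hjk)
      have := div_nonneg hd h0.le
      linarith)
  have hsub : P.real {ω | ∃ t, 0 < t ∧ s ≤ t ∧ a * t + b ≤ countLE (fun i => Y i ω) t} ≤
      P.real {ω | ∃ t ∈ S, a * t + b ≤ countLE (fun i => Y i ω) t} := by
    refine measureReal_mono ?_
    rintro ω ⟨t, h0, hs, ht⟩
    set k := countLE (fun i => Y i ω) t with hk
    have htk : t ≤ τ k := by
      rw [hτ, le_div_iff₀ ha]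
      linarith
    refine ⟨τ k, ?_, ?_⟩
    · simp only [hS, Finset.mem_filter, Finset.mem_image, Finset.mem_range]
      exact ⟨⟨k, Nat.lt_succ_iff.2 (countLE_le_card _ _), rfl⟩, h0.trans_le htk, hs.trans htk⟩
    · rw [hτk]
      exact Nat.cast_le.2 (countLE_mono _ htk)
  linarith [mul_le_mul_of_nonneg_left hsub (sub_nonneg.2 hK1)]

end Maximal

-- DKW, Simes and Wellner inequalities

section Bounds

variable {Ω ι : Type*} [MeasurableSpace Ω] [Fintype ι] {P : Measure Ω} [IsProbabilityMeasure P]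
  {Y : ι → Ω → ℝ} {m : ℕ}

/-- Multiplicative form of the maximal inequality for line crossings. -/
theorem IndepSuperUniform.mul_line_le (hY : IndepSuperUniform P Y) (hm : Fintype.card ι ≤ m)
    {a b s d K : ℝ} (ha : 0 < a) (hab : Fintype.card ι ≤ a + b) (hd : 0 ≤ d) (hK1 : 1 ≤ K)
    (hK : ∀ (t : ℝ) (k : ℕ), 0 < t → s ≤ t → k ≤ Fintype.card ι → a * t + b = k →
      K ≤ (1 + d / t) ^ k) :
    K * P.real {ω | ∃ t, 0 < t ∧ s ≤ t ∧ a * t + b ≤ countLE (fun i => Y i ω) t} ≤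
      (1 + d) ^ m := by
  have h := hY.one_add_mul_line_le ha hab hd hK1 hK
  have h1 : P.real {ω | ∃ t, 0 < t ∧ s ≤ t ∧ a * t + b ≤ countLE (fun i => Y i ω) t} ≤ 1 :=
    measureReal_le_one
  have h2 : (1 + d) ^ Fintype.card ι ≤ (1 + d) ^ m := pow_le_pow_right₀ (by linarith) hm
  linarith

/-- One-sided Dvoretzky–Kiefer–Wolfowitz–Massart inequality. -/
theorem IndepSuperUniform.dkw (hY : IndepSuperUniform P Y) (hm : Fintype.card ι ≤ m) (hm0 : 0 < m)
    {α : ℝ} (hα : α ∈ Set.Ioo (0 : ℝ) 1) :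
    P.real {ω | ∃ t, 0 < t ∧ 0 ≤ t ∧
      m * t + √((m : ℝ) / 2 * Real.log (1 / α)) ≤ countLE (fun i => Y i ω) t} ≤ α := by
  obtain ⟨hα0, hα1⟩ := hα
  have hmR : (0 : ℝ) < m := by exact_mod_cast hm0
  have hn : (Fintype.card ι : ℝ) ≤ m := by exact_mod_cast hm
  have hL : 0 < Real.log (1 / α) := Real.log_pos ((one_lt_div hα0).2 hα1)
  set c := √((m : ℝ) / 2 * Real.log (1 / α)) with hc
  have hc0 : 0 < c := Real.sqrt_pos.2 (by positivity)
  have hc2 : c ^ 2 = m / 2 * Real.log (1 / α) := Real.sq_sqrt (by positivity)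
  by_cases he1 : c / m < 1
  · obtain ⟨d, hd, hgain⟩ := exists_dkw_scale (div_pos hc0 hmR) he1
    have h1d : (1 : ℝ) ≤ (1 + d) ^ m := one_le_pow₀ (by linarith)
    -- `K = (1 + d)^m / α` is what turns the maximal inequality into the bound `α`.
    have hK1 : 1 ≤ (1 + d) ^ m / α := (one_le_div hα0).2 (by linarith)
    have h := hY.mul_line_le (s := 0) hm hmR (b := c) (by linarith) hd.le hK1 (by
      intro t k ht _ hk hkt
      have hte : m * (t + c / m) = k := by rw [mul_add, mul_div_cancel₀ _ hmR.ne', hkt]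
      have hte1 : t + c / m ≤ 1 := by
        have hkn : (k : ℝ) ≤ m := le_trans (by exact_mod_cast hk) hn
        by_contra hcon
        nlinarith
      have hdt : 0 < 1 + d / t := by positivity
      have h1 := mul_le_mul_of_nonneg_left (hgain t ht hte1) hmR.le
      rw [← mul_assoc, hte] at h1
      have h2 : m * (2 * (c / m) ^ 2) = Real.log (1 / α) := by
        rw [div_pow, hc2]
        field_simp
      rw [← Real.log_le_log_iff (by positivity) (by positivity), Real.log_pow,
        div_eq_mul_one_div, Real.log_mul (by positivity) (by positivity), Real.log_pow]
      linarith)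
    rw [div_mul_eq_mul_div, div_le_iff₀ hα0] at h
    exact le_of_mul_le_mul_left h (by positivity)
  -- For `c ≥ m` the line is above `m` at every positive time.
  · have hempty : {ω | ∃ t, 0 < t ∧ 0 ≤ t ∧ m * t + c ≤ countLE (fun i => Y i ω) t} = ∅ := by
      rw [Set.eq_empty_iff_forall_notMem]
      rintro ω ⟨t, ht, -, h⟩
      have h1 : (countLE (fun i => Y i ω) t : ℝ) ≤ m :=
        le_trans (by exact_mod_cast countLE_le_card _ _) hn
      have h2 : (m : ℝ) ≤ c := (one_le_div hmR).1 (not_lt.1 he1)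
      have := mul_pos hmR ht
      linarith
    rw [hempty, measureReal_empty]
    exact hα0.le

/-- Simes' inequality. -/
theorem IndepSuperUniform.simes (hY : IndepSuperUniform P Y) (hm : Fintype.card ι ≤ m) (hm0 : 0 < m)
    {α : ℝ} (hα : α ∈ Set.Ioo (0 : ℝ) 1) :
    P.real {ω | ∃ t, 0 < t ∧ 0 ≤ t ∧ m / α * t + 0 ≤ countLE (fun i => Y i ω) t} ≤ α := by
  obtain ⟨hα0, hα1⟩ := hα
  have hmR : (0 : ℝ) < m := by exact_mod_cast hm0
  have hn : (Fintype.card ι : ℝ) ≤ m := by exact_mod_cast hm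
  have hma : (m : ℝ) ≤ m / α := le_div_self hmR.le hα0 hα1.le
  set p := P.real {ω | ∃ t, 0 < t ∧ 0 ≤ t ∧ m / α * t + 0 ≤ countLE (fun i => Y i ω) t} with hp
  have hstep : ∀ d : ℝ, 0 < d → m / α * p ≤ d⁻¹ * ((1 + d) ^ m - 1) := by
    intro d hd
    -- On the line `k = m t / α`, Bernoulli's inequality gives `(1 + d/t)^k ≥ 1 + k d/t = 1 + d
    -- m/α`, independent of `t`. The form with `K - 1` is needed: after division by `d` it survives
    -- the limit `d → 0`, where the right side tends to the derivative `m`.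
    have h := hY.one_add_mul_line_le (s := 0) (a := m / α) (b := 0) (K := 1 + d * (m / α))
      (by positivity) (by linarith) hd.le (le_add_of_nonneg_right (by positivity)) (by
        intro t k ht _ _ hk
        rw [add_zero] at hk
        refine le_trans (le_of_eq ?_) (one_add_mul_le_pow (a := d / t) ?_ k)
        · rw [← hk]
          field_simp
        · have := div_pos hd ht
          linarith)
    have h2 : (1 + d) ^ Fintype.card ι ≤ (1 + d) ^ m := pow_le_pow_right₀ (by linarith) hm
    rw [← hp] at h
    rw [inv_mul_eq_div, le_div_iff₀ hd]
    linarith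
  have hder : HasDerivAt (fun d : ℝ => (1 + d) ^ m) m 0 := by
    have := ((hasDerivAt_id (0 : ℝ)).const_add 1).fun_pow m
    simpa using this
  have hlim : Filter.Tendsto (fun d : ℝ => d⁻¹ * ((1 + d) ^ m - 1))
      (nhdsWithin 0 (Set.Ioi 0)) (nhds (m : ℝ)) := by
    have := hder.tendsto_slope_zero_right
    simpa using this
  have hle : m / α * p ≤ m := by
    refine ge_of_tendsto hlim ?_
    filter_upwards [self_mem_nhdsWithin] with d hd using hstep d hd
  rw [div_mul_eq_mul_div, div_le_iff₀ hα0] at hle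
  exact le_of_mul_le_mul_left hle hmR

/-- Wellner's inequality: exponential bound for the ratio of the counting process to its mean,
uniformly over times at least `s`. -/
theorem IndepSuperUniform.wellner (hY : IndepSuperUniform P Y) (hm : Fintype.card ι ≤ m)
    (hm0 : 0 < m) {l s : ℝ} (hl : 1 < l) (hs : 0 < s) :
    P.real {ω | ∃ t, 0 < t ∧ s ≤ t ∧ m * l * t + 0 ≤ countLE (fun i => Y i ω) t} ≤
      Real.exp (-(m * s * wellnerH l)) := by
  have hmR : (0 : ℝ) < m := by exact_mod_cast hm0
  have hn : (Fintype.card ι : ℝ) ≤ m := by exact_mod_cast hm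
  have hlog : 0 < Real.log l := Real.log_pos hl
  have hl0 : 0 < l := by linarith
  have hd : 0 ≤ s * (l - 1) := mul_nonneg hs.le (by linarith)
  -- With `d = s (l - 1)` one has `1 + d/s = l`, and `K = l^(m l s)` is the value of `(1 + d/t)^(m l
  -- t)` at `t = s`. Bernoulli's inequality with exponent `s/t ≤ 1` shows that later times give at
  -- least as much.
  have h := hY.mul_line_le (s := s) hm (a := m * l) (b := 0) (K := Real.exp (m * l * s * Real.log l))
    (by positivity) (by nlinarith) hd (Real.one_le_exp (by positivity)) (by
      intro t k ht hst _ hk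
      rw [add_zero] at hk
      have hdt : 0 < 1 + s * (l - 1) / t := by
        have := div_nonneg hd ht.le
        linarith
      have h1 : l ^ (s / t) ≤ 1 + s * (l - 1) / t := by
        have := rpow_one_add_le_one_add_mul_self (s := l - 1) (by linarith)
          (p := s / t) (by positivity) ((div_le_one ht).2 hst)
        rw [add_sub_cancel] at this
        rwa [← div_mul_eq_mul_div]
      have h2 := Real.log_le_log (by positivity) h1
      rw [Real.log_rpow hl0] at h2
      rw [← Real.le_log_iff_exp_le (by positivity), Real.log_pow]
      calc m * l * s * Real.log l = k * (s / t * Real.log l) := by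
            rw [← hk]
            field_simp
        _ ≤ _ := by gcongr)
  have hexp : (1 + s * (l - 1)) ^ m ≤ Real.exp (m * (s * (l - 1))) := by
    rw [Real.exp_nat_mul]
    have := Real.add_one_le_exp (s * (l - 1))
    exact pow_le_pow_left₀ (by linarith) (by linarith) m
  have h3 := h.trans hexp
  rw [mul_comm, ← le_div_iff₀ (Real.exp_pos _), ← Real.exp_sub] at h3
  refine h3.trans_eq ?_
  congr 1
  unfold wellnerH
  ring

end Bounds

-- Uniform Wellner bound by dyadic blocks

theorem strictMonoOn_wellnerH : StrictMonoOn wellnerH (Set.Ioi 1) := by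
  have hd : ∀ x ∈ Set.Ioi (1 : ℝ), HasDerivAt wellnerH (Real.log x) x := by
    intro x hx
    have hx' : x ≠ 0 := (lt_trans one_pos hx).ne'
    have h : HasDerivAt wellnerH (1 * (Real.log x - 1) + x * x⁻¹) x :=
      ((hasDerivAt_id x).mul ((Real.hasDerivAt_log hx').sub_const 1)).add_const 1
    refine h.congr_deriv ?_
    rw [mul_inv_cancel₀ hx']
    ring
  apply strictMonoOn_of_deriv_pos (convex_Ioi 1)
    fun x hx => (hd x hx).continuousAt.continuousWithinAt
  intro x hx
  rw [interior_Ioi] at hx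
  rw [(hd x hx).deriv]
  exact Real.log_pos hx

theorem one_lt_wellnerHInv {y : ℝ} (hy : 0 < y) : 1 < wellnerHInv y :=
  Function.invFunOn_mem (bijOn_wellnerH.surjOn hy)

theorem wellnerH_wellnerHInv {y : ℝ} (hy : 0 < y) : wellnerH (wellnerHInv y) = y :=
  Function.invFunOn_eq (bijOn_wellnerH.surjOn hy)

theorem wellnerHInv_mono {x y : ℝ} (hx : 0 < x) (hxy : x ≤ y) : wellnerHInv x ≤ wellnerHInv y := by
  have hy := hx.trans_le hxy
  rw [← strictMonoOn_wellnerH.le_iff_le (one_lt_wellnerHInv hx) (one_lt_wellnerHInv hy),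
    wellnerH_wellnerHInv hx, wellnerH_wellnerHInv hy]
  exact hxy

section UniformWellner

variable {Ω ι : Type*} [MeasurableSpace Ω] [Fintype ι] {P : Measure Ω} [IsProbabilityMeasure P]
  {Y : ι → Ω → ℝ} {m : ℕ}

/-- The numerator of Wellner's bound at dyadic level `u = log₂(1 / t)`. -/
noncomputable def wellnerLevel (α u : ℝ) : ℝ :=
  2 * Real.log (Real.pi ^ 2 / 6 / α) + 4 * Real.log (1 + u)

theorem one_lt_pi_sq_div {α : ℝ} (hα : α ∈ Set.Ioo (0 : ℝ) 1) : 1 < Real.pi ^ 2 / 6 / α := by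
  obtain ⟨hα0, hα1⟩ := hα
  rw [one_lt_div hα0]
  nlinarith [Real.pi_gt_three]

theorem wellnerLevel_pos {α : ℝ} (hα : α ∈ Set.Ioo (0 : ℝ) 1) {u : ℝ} (hu : 0 ≤ u) :
    0 < wellnerLevel α u := by
  have h1 := Real.log_pos (one_lt_pi_sq_div hα)
  have h2 : 0 ≤ Real.log (1 + u) := Real.log_nonneg (by linarith)
  unfold wellnerLevel
  linarith

theorem wellnerLevel_mono {α u v : ℝ} (hu : 0 ≤ u) (huv : u ≤ v) :
    wellnerLevel α u ≤ wellnerLevel α v := by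
  have h := Real.log_le_log (by linarith : 0 < 1 + u) (by linarith : 1 + u ≤ 1 + v)
  unfold wellnerLevel
  linarith

/-- Halving turns the coefficients `2` and `4` of the level into the exponents `1` and `2`. These
are the error shares of the dyadic blocks, and they sum to `α` since `κ = ∑ 1/(j+1)²`. -/
theorem exp_neg_wellnerLevel {α : ℝ} (hα : α ∈ Set.Ioo (0 : ℝ) 1) (j : ℕ) :
    Real.exp (-(wellnerLevel α j / 2)) = α / (Real.pi ^ 2 / 6) * (1 / ((j + 1 : ℕ) : ℝ) ^ 2) := by
  have h1 : 0 < Real.pi ^ 2 / 6 / α := zero_lt_one.trans (one_lt_pi_sq_div hα)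
  have hα0 := hα.1
  have h2 : (0 : ℝ) < 1 + j := by positivity
  have : -(wellnerLevel α j / 2) = -Real.log (Real.pi ^ 2 / 6 / α * (1 + j) ^ 2) := by
    rw [Real.log_mul h1.ne' (by positivity), Real.log_pow, wellnerLevel]
    push_cast
    ring
  rw [this, Real.exp_neg, Real.exp_log (by positivity)]
  push_cast
  have := Real.pi_pos
  field_simp
  ring

/-- Wellner's inequality, uniformly over all times, by a union bound over dyadic blocks. -/
theorem IndepSuperUniform.uniform_wellner (hY : IndepSuperUniform P Y) (hm : Fintype.card ι ≤ m)
    (hm0 : 0 < m) {α : ℝ} (hα : α ∈ Set.Ioo (0 : ℝ) 1) :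
    P.real {ω | ∃ t, 0 < t ∧ t ≤ 1 ∧
      m * t * wellnerHInv (wellnerLevel α (Real.logb 2 (1 / t)) / (m * t)) ≤
        countLE (fun i => Y i ω) t} ≤ α := by
  have hmR : (0 : ℝ) < m := by exact_mod_cast hm0
  set s : ℕ → ℝ := fun j => (1 / 2) ^ (j + 1) with hs
  have hs0 : ∀ j, 0 < s j := fun j => by positivity
  -- Block `j` is contained in `[s j, 2 s j]`. Wellner's inequality is applied from the left end,
  -- while the right end in the denominator makes `y j` a lower bound for the argument of `h⁻¹`
  -- throughout the block; the ratio of the ends costs the factor `2` in the level.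
  set y : ℕ → ℝ := fun j => wellnerLevel α j / (2 * (m * s j)) with hy
  have hy0 : ∀ j, 0 < y j := fun j =>
    div_pos (wellnerLevel_pos hα (Nat.cast_nonneg j)) (by have := hs0 j; positivity)
  set E : ℕ → Set Ω := fun j => {ω | ∃ t, 0 < t ∧ s j ≤ t ∧
    m * wellnerHInv (y j) * t + 0 ≤ countLE (fun i => Y i ω) t} with hE
  have hEj : ∀ j, P (E j) ≤
      ENNReal.ofReal (α / (Real.pi ^ 2 / 6) * (1 / ((j + 1 : ℕ) : ℝ) ^ 2)) := by
    intro j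
    rw [← ENNReal.ofReal_toReal (measure_ne_top P (E j)), ← exp_neg_wellnerLevel hα]
    refine ENNReal.ofReal_le_ofReal ((hY.wellner hm hm0 (one_lt_wellnerHInv (hy0 j)) (hs0 j)).trans
      (le_of_eq ?_))
    rw [wellnerH_wellnerHInv (hy0 j)]
    congr 2
    have := hs0 j
    simp only [hy]
    field_simp
  have hsub : {ω | ∃ t, 0 < t ∧ t ≤ 1 ∧
      m * t * wellnerHInv (wellnerLevel α (Real.logb 2 (1 / t)) / (m * t)) ≤
        countLE (fun i => Y i ω) t} ⊆ ⋃ j, E j := by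
    rintro ω ⟨t, ht, ht1, h⟩
    have hu : 0 ≤ Real.logb 2 (1 / t) :=
      Real.logb_nonneg (by norm_num) ((one_le_div ht).2 ht1)
    set j := ⌊Real.logb 2 (1 / t)⌋₊ with hj
    have hj1 : (j : ℝ) ≤ Real.logb 2 (1 / t) := Nat.floor_le hu
    have hj2 : Real.logb 2 (1 / t) < (j + 1 : ℕ) := by
      push_cast
      exact Nat.lt_floor_add_one _
    have h1 : (2 : ℝ) ^ j ≤ 1 / t := by
      rw [Real.le_logb_iff_rpow_le (by norm_num) (by positivity), Real.rpow_natCast] at hj1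
      exact hj1
    have h2 : 1 / t < (2 : ℝ) ^ (j + 1) := by
      rw [Real.logb_lt_iff_lt_rpow (by norm_num) (by positivity), Real.rpow_natCast] at hj2
      exact hj2
    have hst : s j ≤ t := by
      simp only [hs]
      rw [one_div_pow]
      exact (one_div_lt ht (by positivity)).1 h2 |>.le
    have hts : t ≤ 2 * s j := by
      have : 2 * s j = 1 / 2 ^ j := by
        simp only [hs]
        rw [pow_succ, one_div_pow]
        ring
      rw [this]
      exact (le_one_div (by positivity) ht).1 h1
    refine Set.mem_iUnion.2 ⟨j, t, ht, hst, ?_⟩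
    rw [add_zero]
    refine le_trans ?_ h
    have hmono : y j ≤ wellnerLevel α (Real.logb 2 (1 / t)) / (m * t) := by
      refine div_le_div₀ (wellnerLevel_pos hα hu).le
        (wellnerLevel_mono (Nat.cast_nonneg j) hj1) (by positivity) ?_
      have := mul_le_mul_of_nonneg_left hts hmR.le
      linarith
    have := mul_le_mul_of_nonneg_left (wellnerHInv_mono (hy0 j) hmono) (mul_pos hmR ht).le
    linarith
  have hsum : HasSum (fun j : ℕ => α / (Real.pi ^ 2 / 6) * (1 / ((j + 1 : ℕ) : ℝ) ^ 2)) α := by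
    have h0 : HasSum (fun j : ℕ => 1 / ((j + 1 : ℕ) : ℝ) ^ 2) (Real.pi ^ 2 / 6) := by
      have := (hasSum_nat_add_iff' (f := fun j : ℕ => 1 / (j : ℝ) ^ 2) 1).2 hasSum_zeta_two
      simpa using this
    have h1 := h0.mul_left (α / (Real.pi ^ 2 / 6))
    rwa [div_mul_cancel₀ _ (by have := Real.pi_pos; positivity)] at h1
  refine ENNReal.toReal_le_of_le_ofReal hα.1.le ?_
  calc P _ ≤ P (⋃ j, E j) := measure_mono hsub
    _ ≤ ∑' j, P (E j) := measure_iUnion_le _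
    _ ≤ ∑' j : ℕ, ENNReal.ofReal (α / (Real.pi ^ 2 / 6) * (1 / ((j + 1 : ℕ) : ℝ) ^ 2)) :=
        ENNReal.tsum_le_tsum hEj
    _ = ENNReal.ofReal α := by
        rw [← ENNReal.ofReal_tsum_of_nonneg (fun j => ?_) hsum.summable, hsum.tsum_eq]
        have := hα.1
        positivity

end UniformWellner

-- From the joint error rate to boundary crossing

section Reduction

variable {Ω : Type*} [MeasurableSpace Ω] {P : Measure Ω} [IsProbabilityMeasure P] {m : ℕ}

/-- The joint error rate of a top-`k` family is at most the probability that the counting process of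
the true null `p`-values exceeds the bound function at some time in `(0, 1]`. -/
theorem JER_topKFamily_le (f : ℝ → ℕ) (x : Ω → Fin m → ℝ) (σ : Ω → Equiv.Perm (Fin m))
    (hσ : ∀ ω, Orders (σ ω) (x ω)) (hx : ∀ ω i, x ω i ≤ 1) (H₀ : Finset (Fin m))
    (hY : IndepSuperUniform P fun (i : H₀) ω => x ω i) :
    JER P (fun ω => topKFamily f (x ω) (σ ω)) H₀ ≤
      P.real {ω | ∃ t, 0 < t ∧ t ≤ 1 ∧ f t < countLE (fun i : H₀ => x ω i) t} := by
  -- Super-uniformity at `0` excludes null `p`-values equal to zero, so setting `ζ_k = 0` when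
  -- `p_(k) = 0` costs nothing.
  have hpos : ∀ᵐ ω ∂P, ∀ i : H₀, 0 < x ω i := by
    refine Filter.eventually_all.2 fun i => ?_
    have h := hY.superUniform i 0
    rw [min_eq_left zero_le_one, max_self] at h
    have h0 := (measureReal_eq_zero_iff (measure_ne_top _ _)).1 (le_antisymm h measureReal_nonneg)
    rw [ae_iff]
    simpa only [not_lt] using h0
  refine ENNReal.toReal_mono (measure_ne_top _ _) (measure_mono_ae ?_)
  filter_upwards [hpos] with ω hω
  rintro ⟨k, hk⟩
  set t := orderStat (x ω) k with ht
  have hmem : ∀ i ∈ (Finset.Iic k).image (σ ω), x ω i ≤ t := by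
    intro i hi
    obtain ⟨l, hl, rfl⟩ := Finset.mem_image.1 hi
    have := (orders_iff_monotone _ _).1 (hσ ω) (Finset.mem_Iic.1 hl)
    rw [ht, ← hσ ω k]
    exact this
  have hcard : ((Finset.Iic k).image (σ ω) ∩ H₀).card ≤ countLE (fun i : H₀ => x ω i) t := by
    rw [countLE, ← Finset.card_map (Function.Embedding.subtype fun i => i ∈ H₀)]
    refine Finset.card_le_card fun i hi => ?_
    rw [Finset.mem_inter] at hi
    exact Finset.mem_map.2 ⟨⟨i, hi.2⟩, by simpa using hmem i hi.1, rfl⟩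
  have ht0 : 0 < t := by
    have hne : ((Finset.Iic k).image (σ ω) ∩ H₀).Nonempty :=
      Finset.card_pos.1 (lt_of_le_of_lt (Nat.zero_le _) hk)
    obtain ⟨i, hi⟩ := hne
    rw [Finset.mem_inter] at hi
    exact (hω ⟨i, hi.2⟩).trans_le (hmem i hi.1)
  have hk1 : ((Finset.Iic k).image (σ ω) ∩ H₀).card ≤ (k : ℕ) + 1 := by
    refine (Finset.card_le_card Finset.inter_subset_left).trans (Finset.card_image_le.trans ?_)
    rw [Fin.card_Iic]
  have hlt : f t < ((Finset.Iic k).image (σ ω) ∩ H₀).card := by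
    have h : min ((Set.Ioi (0 : ℝ)).indicator f t) ((k : ℕ) + 1) <
        ((Finset.Iic k).image (σ ω) ∩ H₀).card := hk
    rw [Set.indicator_of_mem (Set.mem_Ioi.2 ht0)] at h
    omega
  exact ⟨t, ht0, hx ω _, hlt.trans_le hcard⟩

end Reduction

/-- Under the standing assumptions the true null `p`-values of an observation with law `μ` are
independent and super-uniform. -/
theorem Problem.indepSuperUniform {𝓧 Ω : Type*} [MeasurableSpace 𝓧] [MeasurableSpace Ω] {m : ℕ}
    (T : Problem 𝓧 m) (hsu : T.SuperUniformUnderNull) (hind : T.IndependentUnderNull)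
    {μ : Measure 𝓧} (hμ : μ ∈ T.model) {P : Measure Ω} [IsProbabilityMeasure P] {X : Ω → 𝓧}
    (hX : HasLaw X μ P) :
    IndepSuperUniform P fun (i : T.trueNulls μ) ω => T.pval i (X ω) := by
  have hmeas : ∀ i : T.trueNulls μ, AEMeasurable (fun ω => T.pval i (X ω)) P := fun i =>
    (T.measurable_pval i).comp_aemeasurable hX.aemeasurable
  have := T.isProbabilityMeasure μ hμ
  refine ⟨hmeas, ?_, fun i x => ?_⟩
  · have hlaw : ∀ i : T.trueNulls μ, HasLaw (T.pval i) (μ.map (T.pval i)) μ := fun i =>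
      ⟨(T.measurable_pval i).aemeasurable, rfl⟩
    -- Independence is a statement about the joint law being a product, and so passes from `μ` to
    -- `P` along `X`.
    exact (iIndepFun_iff_hasLaw_pi_pi fun i => (hlaw i).fun_comp hX).2
      (((hind μ hμ).hasLaw_pi hlaw).fun_comp hX)
  · refine (hX.measureReal_eq (p := fun y => T.pval i y ≤ x)
      (measurableSet_le (T.measurable_pval i) measurable_const)).trans_le ?_
    exact hsu μ hμ i i.2 x

end MultipleTesting

theorem mainTheorem10 {𝓧 Ω : Type*} [MeasurableSpace 𝓧] [MeasurableSpace Ω] {m : ℕ}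
    (T : Problem 𝓧 m) (hsu : T.SuperUniformUnderNull) (hind : T.IndependentUnderNull)
    (α : ℝ) (hα : α ∈ Set.Ioo (0 : ℝ) 1) (μ : Measure 𝓧) (hμ : μ ∈ T.model)
    (P : Measure Ω) [IsProbabilityMeasure P] (X : Ω → 𝓧) (hX : HasLaw X μ P)
    (σ : Ω → Equiv.Perm (Fin m)) (hσ : ∀ ω, Orders (σ ω) (fun i => T.pval i (X ω))) :
    JER P (fun ω => topKFamily (dkwBound m α) (fun i => T.pval i (X ω)) (σ ω))
        (T.trueNulls μ) ≤ α ∧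
      JER P (fun ω => topKFamily (wellnerBound m α) (fun i => T.pval i (X ω)) (σ ω))
        (T.trueNulls μ) ≤ α ∧
      JER P (fun ω => topKFamily (simesBound m α) (fun i => T.pval i (X ω)) (σ ω))
        (T.trueNulls μ) ≤ α := by
  have hα0 := hα.1
  rcases Nat.eq_zero_or_pos m with rfl | hm0
  · simp [JER, hα0.le]
  have hY := T.indepSuperUniform hsu hind hμ hX
  have hm : Fintype.card (T.trueNulls μ) ≤ m := by
    rw [Fintype.card_coe]
    exact card_finset_fin_le _
  have hred := fun f => JER_topKFamily_le f (fun ω i => T.pval i (X ω)) σ hσ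
    (fun ω i => (T.pval_mem i (X ω)).2) (T.trueNulls μ) hY
  refine ⟨(hred _).trans ((measureReal_mono ?_).trans (hY.dkw hm hm0 hα)),
    (hred _).trans ((measureReal_mono ?_).trans (hY.uniform_wellner hm hm0 hα)),
    (hred _).trans ((measureReal_mono ?_).trans (hY.simes hm hm0 hα))⟩
  · rintro ω ⟨t, ht, -, h⟩
    exact ⟨t, ht, ht.le, (Nat.lt_of_floor_lt h).le⟩
  · rintro ω ⟨t, ht, ht1, h⟩
    exact ⟨t, ht, ht1, (Nat.lt_of_floor_lt h).le⟩
  · rintro ω ⟨t, ht, -, h⟩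
    refine ⟨t, ht, ht.le, ?_⟩
    have hmR : (0 : ℝ) < m := by exact_mod_cast hm0
    -- Exceeding `⌈m t / α⌉ - 1` means reaching `m t / α`: the left limit of the floor matches the
    -- non-strict crossing in Simes' inequality.
    have hfl := floorLeft_eq (t := m * t / α) (by positivity)
    have hz : ⌈m * t / α⌉ ≤ (countLE (fun i : T.trueNulls μ => T.pval i (X ω)) t : ℤ) := by
      have h' : floorLeft (m * t / α) < countLE (fun i : T.trueNulls μ => T.pval i (X ω)) t := h
      omega
    have := Int.ceil_le.1 hz
    rw [add_zero, div_mul_eq_mul_div]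
    exact_mod_cast this
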